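/- Let $A\in\{0,1\}^{m\times n}$ be a zero-one matrix, let $b\in\mathbb{N}^m$ be a non-negative integral constraint vector, let $w\in\mathbb{R}^n$ be a weight vector, and let $X\in\mathbb{N}^n$ be a vector of upper bounds ($0\in\mathbb{N}$). The packing integer program is $\max\{w^Tx : Ax\le b,\ x\in\prod_i\{0,\dots,X_i\}\}$. Its LP relaxation, the packing LP, is $\max\{w^Tx : Ax\le b,\ x\in\prod_i[0,X_i]\}$, and $\mathrm{OPT}_{LP}$ is the set of optimal solutions of the packing LP. Let $G$ be the bipartite factor graph with variable vertices $v_1,\dots,v_n$, constraint vertices $C_1,\dots,C_m$, and an edge between $v_i$ and $C_j$ iff $A_{ji}=1$. Write $\mathcal{N}(\cdot)$ for neighborhoods in $G$ and $\varphi_{v_i}(\beta)=w_i\beta$; index the coordinates of vectors by the corresponding vertices. Min-sum-packing with zero initialization, run for $t\ge 0$ iterations, computes messages with values in $\mathbb{R}\cup\{-\infty\}$ along the edges $(v,C)$, for all $\beta\in\{0,\dots,X_v\}$, as follows. Initially $\mu^{(0)}_{C\to v}(\beta)=0$. For $t'=1,\dots,t$, $$\mu^{(t')}_{v\to C}(\beta)=\varphi_v(\beta)+\sum_{C'\in\mathcal{N}(v)\setminus\{C\}}\mu^{(t'-1)}_{C'\to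 v}(\beta),$$ $$\mu^{(t')}_{C\to v}(\beta)=\max\Big\{\sum_{u\in\mathcal{N}(C)\setminus\{v\}}\mu^{(t')}_{u\to C}(z_u)\ \Big|\ z\in\prod_i\{0,\dots,X_i\},\ z_v=\beta,\ \sum_{u\in\mathcal{N}(C)}z_u\le b_C\Big\},$$ where the maximum of the empty set is $-\infty$. Finally, $$\mu_v(\beta)=\varphi_v(\beta)+\sum_{C\in\mathcal{N}(v)}\mu^{(t)}_{C\to v}(\beta),$$ and $\delta_{v,t}$ is the set of all $\beta\in\{0,\dots,X_v\}$ that maximize $\mu_v(\beta)$ over $\{0,\dots,X_v\}$. Theorem (weak oscillation). For every variable vertex $r$ and every $t\ge 0$, all the maxima and minima below exist, and: 1. if $t$ is even, then $\max\delta_{r,t}\ \ge\ \max\{x_r : x\in\mathrm{OPT}_{LP}\}$; 2. if $t$ is odd, then $\min\delta_{r,t}\ \le\ \min\{x_r : x\in\mathrm{OPT}_{LP}\}$. -/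

import Mathlib

open scoped BigOperators

noncomputable section

namespace MinSum

/-- An instance of the packing problem: a zero-one constraint matrix `A` with `m` rows and `n`
columns, a non-negative integral constraint vector `b`, a real weight vector `w`, and a vector `X`
of upper bounds on the variables. -/
structure PackingInstance (m n : ℕ) where
  /-- the constraint matrix -/
  A : Matrix (Fin m) (Fin n) ℝ
  /-- the constraint matrix is zero-one -/
  zero_one : ∀ j i, A j i = 0 ∨ A j i = 1
  /-- the constraint vector -/
  b : Fin m → ℕ
  /-- the weight vector -/
  w : Fin n → ℝ
  /-- the box constraints -/
  X : Fin n → ℕ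

/-- The feasible region of the packing LP: `A x ≤ b` and `0 ≤ x ≤ X`. -/
def PackingInstance.lpFeasible {m n : ℕ} (P : PackingInstance m n) : Set (Fin n → ℝ) :=
  {x | P.A.mulVec x ≤ (fun j => (P.b j : ℝ)) ∧ ∀ i, 0 ≤ x i ∧ x i ≤ (P.X i : ℝ)}

/-- The set of optimal solutions of the packing LP (maximize `wᵀ x`). -/
def PackingInstance.optLP {m n : ℕ} (P : PackingInstance m n) : Set (Fin n → ℝ) :=
  {x | x ∈ P.lpFeasible ∧ ∀ y ∈ P.lpFeasible, P.w ⬝ᵥ y ≤ P.w ⬝ᵥ x}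

/-- A factor graph model `⟨G, Ψ, Φ, X⟩` with variable vertices `V` and constraint vertices `C`. The
values of the factor functions and of the messages are in `ℝ ∪ {-∞}`, that is `WithBot ℝ`. -/
structure FactorGraphModel (V C : Type*) where
  /-- the factor graph -/
  G : SimpleGraph (V ⊕ C)
  /-- the factor functions -/
  Ψ : C → (V → ℕ) → WithBot ℝ
  /-- the variable functions -/
  Φ : V → ℕ → ℝ
  /-- the alphabet of the variable vertex `v` is `{0, …, X v}` -/
  X : V → ℕ

/-- The bipartite graph that represents the matrix `A`: column `i` and row `j` are adjacent iff
`A j i = 1`. -/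
def PackingInstance.graph {m n : ℕ} (P : PackingInstance m n) :
    SimpleGraph (Fin n ⊕ Fin m) where
  Adj p q :=
    match p, q with
    | Sum.inl i, Sum.inr j => P.A j i = 1
    | Sum.inr j, Sum.inl i => P.A j i = 1
    | _, _ => False
  symm := ⟨by rintro (i | j) (i' | j') h <;> exact h⟩
  loopless := ⟨by rintro (i | j) h <;> exact h⟩

open Classical in
/-- The factor graph model of the packing integer program. -/
def PackingInstance.model {m n : ℕ} (P : PackingInstance m n) :
    FactorGraphModel (Fin n) (Fin m) where
  G := P.graph
  Ψ j y := if ∑ i with P.graph.Adj (Sum.inr j) (Sum.inl i), y i ≤ P.b j then 0 else ⊥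
  Φ i β := P.w i * (β : ℝ)
  X := P.X

namespace FactorGraphModel

variable {V C : Type*} [Fintype V] [Fintype C]

open Classical in
/-- The constraint vertices adjacent to the variable vertex `v`. -/
def varNbrs (M : FactorGraphModel V C) (v : V) : Finset C :=
  {c | M.G.Adj (Sum.inl v) (Sum.inr c)}

open Classical in
/-- The variable vertices adjacent to the constraint vertex `c`. -/
def conNbrs (M : FactorGraphModel V C) (c : C) : Finset V :=
  {v | M.G.Adj (Sum.inr c) (Sum.inl v)}

/-- The alphabet `{0, …, X v}` of the variable vertex `v`. -/
def alphabet (M : FactorGraphModel V C) (v : V) : Finset ℕ := Finset.range (M.X v + 1)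

open Classical in
/-- The integral assignments that satisfy the box constraints. -/
def zBox (M : FactorGraphModel V C) : Finset (V → ℕ) := Fintype.piFinset M.alphabet

open Classical in
/-- The message from `v` to `c` for the value `β`, computed from the constraint-to-variable
messages `μ` of the previous iteration. -/
def varMessage (M : FactorGraphModel V C) (μ : C → V → ℕ → WithBot ℝ) (v : V) (c : C) (β : ℕ) :
    WithBot ℝ :=
  (M.Φ v β : WithBot ℝ) + ∑ c' ∈ M.varNbrs v \ {c}, μ c' v β

open Classical in
/-- The message from `c` to `v` for the value `β` in iteration `t`; the maximum over the empty set
is `-∞`. The messages of iteration `0` are zero. -/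
def conMessage (M : FactorGraphModel V C) : ℕ → C → V → ℕ → WithBot ℝ
  | 0 => fun _ _ _ => 0
  | t + 1 => fun c v β =>
      (M.zBox.filter fun z => z v = β ∧ M.Ψ c z = 0).sup fun z =>
        ∑ u ∈ M.conNbrs c \ {v}, M.varMessage (M.conMessage t) u c (z u)

/-- The final value `μ_v(β)` computed by `v` for the value `β` after `t` iterations. -/
def finalValue (M : FactorGraphModel V C) (t : ℕ) (v : V) (β : ℕ) : WithBot ℝ :=
  (M.Φ v β : WithBot ℝ) + ∑ c ∈ M.varNbrs v, M.conMessage t c v β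

open Classical in
/-- The set `δ_{v,t}` of the values in the alphabet of `v` that maximize the final value. -/
def delta (M : FactorGraphModel V C) (t : ℕ) (v : V) : Finset ℕ :=
  (M.alphabet v).filter fun β => M.finalValue t v β = (M.alphabet v).sup (M.finalValue t v)

end FactorGraphModel

end MinSum

end

/-!
At an optimal solution `x` of the packing LP, duality provides prices `y ≥ 0` for the constraints
that satisfy complementary slackness. Fix a direction `d = ±1` and consider unit steps of values
of variables in direction `d` towards their coordinate of `x`. The weight of `v` minus the total
price at `v` does not decrease in such a step. When `v` makes the step inside an assignment that
satisfies a constraint `c`, some other variable of `c` can make the opposite step, also towards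
`x`, so that the load of `c` does not change, unless the new assignment still satisfies `c` and
`0 ≤ d * y c`. By induction on `t`, the messages from `c` in iteration `t` therefore lose at most
`d * y c` in a step of direction `d = (-1) ^ t`, because a bound in direction `-d` on the messages
to `c` turns into a bound in direction `d` on the messages from `c`. The prices cancel in the
final values, so these do not decrease in steps of direction `(-1) ^ t` towards `x`, and the
extreme maximizer in that direction cannot lie strictly before `x`.
-/

namespace MinSum

section Duality

open Module (Dual)

variable {𝕜 E ι κ : Type*} [Field 𝕜]

section Multipliers

variable [AddCommGroup E] [Module 𝕜 E]

/-- The projection along the functional `g` onto the functionals that vanish at `z`; it serves to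
eliminate one inequality in Farkas' lemma. It is a projection only if `g z ≠ 0`. -/
def projAlong (g : Dual 𝕜 E) (z : E) : Dual 𝕜 E →ₗ[𝕜] Dual 𝕜 E :=
  LinearMap.id - (Dual.eval 𝕜 E z).smulRight ((g z)⁻¹ • g)

theorem projAlong_apply (g f : Dual 𝕜 E) (z x : E) :
    projAlong g z f x = f x - f z * ((g z)⁻¹ * g x) := by
  simp [projAlong]

theorem projAlong_apply_eq_apply_sub (g f : Dual 𝕜 E) (z x : E) :
    projAlong g z f x = f (x - ((g z)⁻¹ * g x) • z) := by
  rw [projAlong_apply, map_sub, map_smul, smul_eq_mul, mul_comm (f z)]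

variable [LinearOrder 𝕜] [IsStrictOrderedRing 𝕜]

theorem nonneg_of_mem_hull {s : Set (Dual 𝕜 E)} {f : Dual 𝕜 E} (hf : f ∈ PointedCone.hull 𝕜 s)
    {x : E} (hx : ∀ g ∈ s, 0 ≤ g x) : 0 ≤ f x := by
  induction hf using Submodule.span_induction with
  | mem g hg => exact hx g hg
  | zero => exact le_rfl
  | add g₁ g₂ _ _ h₁ h₂ => exact add_nonneg h₁ h₂
  | smul r g _ h => exact mul_nonneg r.2 h

theorem mem_hull_insert_of_projAlong_mem_map {s : Set (Dual 𝕜 E)} {f g : Dual 𝕜 E} {z : E}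
    (hs : ∀ h ∈ s, 0 ≤ h z) (hf : f z ≤ 0) (hg : g z < 0)
    (hproj : projAlong g z f ∈ (PointedCone.hull 𝕜 s).map (projAlong g z)) :
    f ∈ PointedCone.hull 𝕜 (insert g s) := by
  obtain ⟨v, hv, hvf⟩ := PointedCone.mem_map.1 hproj
  have hvz : 0 ≤ v z := nonneg_of_mem_hull hv hs
  have hcoeff : 0 ≤ (f z - v z) * (g z)⁻¹ :=
    mul_nonneg_of_nonpos_of_nonpos (by linarith) (inv_nonpos.2 hg.le)
  refine Submodule.mem_span_insert.2 ⟨⟨_, hcoeff⟩, v, hv, LinearMap.ext fun x => ?_⟩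
  change f x = (f z - v z) * (g z)⁻¹ * g x + v x
  have hx := LinearMap.congr_fun hvf x
  rw [projAlong_apply, projAlong_apply] at hx
  linear_combination -hx

/-- **Farkas' lemma** for finitely many functionals. -/
theorem mem_hull_image_of_forall_nonneg (s : Finset ι) (a : ι → Dual 𝕜 E) (w : Dual 𝕜 E)
    (h : ∀ x, (∀ k ∈ s, 0 ≤ a k x) → 0 ≤ w x) : w ∈ PointedCone.hull 𝕜 (a '' s) := by
  classical
  induction s using Finset.induction_on generalizing a w with
  | empty =>
    have hw : w = 0 := LinearMap.ext fun x =>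
      le_antisymm (by simpa using h (-x) (by simp)) (h x (by simp))
    exact hw ▸ zero_mem _
  | insert j s _ ih =>
    rw [Finset.coe_insert, Set.image_insert_eq]
    by_cases hs : ∀ x, (∀ k ∈ s, 0 ≤ a k x) → 0 ≤ w x
    · exact Submodule.span_mono (Set.subset_insert _ _) (ih a w hs)
    push Not at hs
    obtain ⟨z, hz, hwz⟩ := hs
    have hjz : a j z < 0 := by
      by_contra! hjz
      exact hwz.not_ge (h z ((Finset.forall_mem_insert _ _ _).2 ⟨hjz, hz⟩))
    refine mem_hull_insert_of_projAlong_mem_map (by simpa using hz) hwz.le hjz ?_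
    rw [PointedCone.map, Submodule.map_span]
    change _ ∈ PointedCone.hull 𝕜 (projAlong (a j) z '' (a '' s))
    rw [Set.image_image]
    refine ih _ _ fun x hx => ?_
    simp only [projAlong_apply_eq_apply_sub] at hx ⊢
    refine h _ ((Finset.forall_mem_insert _ _ _).2 ⟨?_, hx⟩)
    rw [← projAlong_apply_eq_apply_sub, projAlong_apply, mul_inv_cancel_left₀ hjz.ne, sub_self]

theorem exists_nonneg_eq_sum_smul_of_forall_nonneg [Fintype ι] (a : ι → Dual 𝕜 E) (w : Dual 𝕜 E)
    (h : ∀ x, (∀ k, 0 ≤ a k x) → 0 ≤ w x) : ∃ l : ι → 𝕜, 0 ≤ l ∧ w = ∑ k, l k • a k := by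
  have hw := mem_hull_image_of_forall_nonneg Finset.univ a w (by simpa using h)
  rw [Finset.coe_univ, Set.image_univ, PointedCone.hull,
    Submodule.mem_span_range_iff_exists_fun] at hw
  obtain ⟨l, hl⟩ := hw
  exact ⟨fun k => l k, fun k => (l k).2, hl.symm⟩

theorem exists_dual_solution [Fintype ι] (a : ι → Dual 𝕜 E) (c : ι → 𝕜) (w : Dual 𝕜 E) {x : E}
    (hx : ∀ k, a k x ≤ c k) (hopt : ∀ x', (∀ k, a k x' ≤ c k) → w x' ≤ w x) :
    ∃ l : ι → 𝕜, 0 ≤ l ∧ w = ∑ k, l k • a k ∧ ∑ k, l k * c k ≤ w x := by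
  -- Homogenize: on `E × 𝕜`, the functional `w x • s - w p` is nonnegative on the cone cut out by
  -- `0 ≤ s` and `a k p ≤ s • c k`.
  let hom : Dual 𝕜 E → 𝕜 → Dual 𝕜 (E × 𝕜) :=
    fun f γ => γ • LinearMap.snd 𝕜 E 𝕜 - f ∘ₗ LinearMap.fst 𝕜 E 𝕜
  have hom_apply : ∀ f γ p s, hom f γ (p, s) = γ * s - f p := fun f γ p s => by simp [hom]
  obtain ⟨l, hl, hw⟩ := exists_nonneg_eq_sum_smul_of_forall_nonneg
    (fun k : Option ι => k.elim (LinearMap.snd 𝕜 E 𝕜) fun k => hom (a k) (c k)) (hom w (w x)) <| by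
    rintro ⟨p, s⟩ hps
    have hs : 0 ≤ s := hps none
    have hs' : 0 < s + 1 := by linarith
    have hp : ∀ k, a k p ≤ c k * s := fun k => by
      simpa [hom_apply] using hps (some k)
    have hle := hopt ((s + 1)⁻¹ • (x + p)) fun k => by
      rw [map_smul, map_add, smul_eq_mul, inv_mul_le_iff₀ hs']
      linarith [hx k, hp k]
    rw [map_smul, map_add, smul_eq_mul, inv_mul_le_iff₀ hs'] at hle
    rw [hom_apply]
    linarith
  have hw_apply : ∀ p s, w x * s - w p = l none * s + ∑ k, l (some k) * (c k * s - a k p) :=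
    fun p s => by simpa [hom_apply, Fintype.sum_option] using LinearMap.congr_fun hw (p, s)
  refine ⟨fun k => l (some k), fun k => hl (some k), LinearMap.ext fun p => ?_, ?_⟩
  · simpa using hw_apply p 0
  · have hwx : w x = l none + ∑ k, l (some k) * c k := by simpa using hw_apply 0 1
    exact hwx ▸ le_add_of_nonneg_left (hl none)

theorem exists_multipliers [Fintype ι] (a : ι → Dual 𝕜 E) (c : ι → 𝕜) (w : Dual 𝕜 E) {x : E}
    (hx : ∀ k, a k x ≤ c k) (hopt : ∀ x', (∀ k, a k x' ≤ c k) → w x' ≤ w x) :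
    ∃ l : ι → 𝕜, 0 ≤ l ∧ w = ∑ k, l k • a k ∧ ∀ k, a k x < c k → l k = 0 := by
  obtain ⟨l, hl, hw, hle⟩ := exists_dual_solution a c w hx hopt
  have hgap : ∀ k ∈ Finset.univ, 0 ≤ l k * (c k - a k x) := fun k _ =>
    mul_nonneg (hl k) (sub_nonneg.2 (hx k))
  have hsum : ∑ k, l k * (c k - a k x) = 0 := by
    refine le_antisymm ?_ (Finset.sum_nonneg hgap)
    have hwx : w x = ∑ k, l k * a k x := by simpa using LinearMap.congr_fun hw x
    simp only [mul_sub, Finset.sum_sub_distrib]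
    linarith
  refine ⟨l, hl, hw, fun k hk => ?_⟩
  have := (Finset.sum_eq_zero_iff_of_nonneg hgap).1 hsum k (Finset.mem_univ k)
  exact (mul_eq_zero.1 this).resolve_right (sub_pos.2 hk).ne'

end Multipliers

open Matrix in
theorem exists_shadowPrices [LinearOrder 𝕜] [IsStrictOrderedRing 𝕜] [Fintype ι] [Fintype κ]
    {A : Matrix κ ι 𝕜} {b : κ → 𝕜} {u w x : ι → 𝕜}
    (hx : A *ᵥ x ≤ b ∧ ∀ i, 0 ≤ x i ∧ x i ≤ u i)
    (hopt : ∀ x', (A *ᵥ x' ≤ b ∧ ∀ i, 0 ≤ x' i ∧ x' i ≤ u i) → w ⬝ᵥ x' ≤ w ⬝ᵥ x) :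
    ∃ y : κ → 𝕜, 0 ≤ y ∧ (∀ j, (A *ᵥ x) j < b j → y j = 0) ∧
      (∀ i, 0 < x i → (y ᵥ* A) i ≤ w i) ∧ ∀ i, x i < u i → w i ≤ (y ᵥ* A) i := by
  classical
  let a : κ ⊕ ι ⊕ ι → Dual 𝕜 (ι → 𝕜) :=
    Sum.elim (fun j => LinearMap.proj j ∘ₗ A.mulVecLin)
      (Sum.elim (fun i => LinearMap.proj i) fun i => -LinearMap.proj i)
  let c : κ ⊕ ι ⊕ ι → 𝕜 := Sum.elim b (Sum.elim u 0)
  have hfeas : ∀ x', (∀ k, a k x' ≤ c k) ↔ A *ᵥ x' ≤ b ∧ ∀ i, 0 ≤ x' i ∧ x' i ≤ u i := fun x' => by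
    simp [a, c, Pi.le_def, forall_and, and_comm]
  obtain ⟨l, hl, hw, hslack⟩ := exists_multipliers a c (dotProductBilin 𝕜 𝕜 w) ((hfeas x).2 hx)
    fun x' hx' => hopt x' ((hfeas x').1 hx')
  have hwi : ∀ i,
      w i = ((l ∘ Sum.inl) ᵥ* A) i + l (.inr (.inl i)) - l (.inr (.inr i)) := fun i => by
    simpa [a, Pi.single_apply, Fintype.sum_sum_type, vecMul, dotProduct, ← add_sub_assoc,
      ← sub_eq_add_neg] using LinearMap.congr_fun hw (Pi.single i 1)
  refine ⟨l ∘ Sum.inl, fun j => hl _, fun j hj => hslack _ hj, fun i hi => ?_, fun i hi => ?_⟩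
  · have h₀ : l (.inr (.inr i)) = 0 := hslack _ (by simpa [a, c] using hi)
    have h₁ : 0 ≤ l (.inr (.inl i)) := hl _
    linarith [hwi i]
  · have h₀ : l (.inr (.inl i)) = 0 := hslack _ hi
    have h₁ : 0 ≤ l (.inr (.inr i)) := hl _
    linarith [hwi i]

end Duality

section UnitStep

/-- `β'` is obtained from `β` by the unit step in direction `d = ±1`, the step goes from `β` towards
`a` (it may overshoot), and it stays inside the alphabet `{0, …, N}`. -/
structure UnitStep (N : ℕ) (d : ℤˣ) (a : ℝ) (β β' : ℕ) : Prop where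
  source_le : β ≤ N
  target_le : β' ≤ N
  target_eq : (β' : ℤ) = β + d
  towards : (d : ℝ) * β < d * a

/-- A unit step in direction `d` towards `a` decreases the objective `f` by at most `k`; for
negative `k` it increases `f` by at least `-k`. -/
def StepLossLE (N : ℕ) (d : ℤˣ) (a k : ℝ) (f : ℕ → WithBot ℝ) : Prop :=
  ∀ ⦃β β' : ℕ⦄, UnitStep N d a β β' → f β ≤ f β' + k

variable {N β β' : ℕ} {d : ℤˣ} {a k l : ℝ} {f g : ℕ → WithBot ℝ}

theorem exists_unitStep (ha : a ∈ Set.Icc 0 (N : ℝ)) (hβ : β ≤ N) (h : (d : ℝ) * β < d * a) :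
    ∃ β', UnitStep N d a β β' := by
  rcases Int.units_eq_one_or d with rfl | rfl
  · have hlt : β < N := by
      have : (β : ℝ) < a := by simpa using h
      exact_mod_cast this.trans_le ha.2
    exact ⟨β + 1, hβ, hlt, by simp, h⟩
  · have hpos : 0 < β := by
      have : a < β := by simpa using h
      exact_mod_cast ha.1.trans_lt this
    exact ⟨β - 1, hβ, by lia, by push_cast [Nat.one_le_iff_ne_zero.2 hpos.ne']; ring, h⟩

theorem StepLossLE.add (hf : StepLossLE N d a k f) (hg : StepLossLE N d a l g) :
    StepLossLE N d a (k + l) fun β => f β + g β := fun β β' h => by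
  calc f β + g β ≤ (f β' + k) + (g β' + l) := add_le_add (hf h) (hg h)
    _ = f β' + g β' + (k + l : ℝ) := by rw [WithBot.coe_add]; abel

theorem StepLossLE.sum {ι : Type*} {s : Finset ι} {k : ι → ℝ} {f : ι → ℕ → WithBot ℝ}
    (hf : ∀ i ∈ s, StepLossLE N d a (k i) (f i)) :
    StepLossLE N d a (∑ i ∈ s, k i) fun β => ∑ i ∈ s, f i β := fun β β' h => by
  calc ∑ i ∈ s, f i β ≤ ∑ i ∈ s, (f i β' + k i) := Finset.sum_le_sum fun i hi => hf i hi h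
    _ = ∑ i ∈ s, f i β' + (∑ i ∈ s, k i : ℝ) := by rw [Finset.sum_add_distrib, WithBot.coe_sum]

theorem StepLossLE.const {y : WithBot ℝ} (hk : 0 ≤ k) : StepLossLE N d a k fun _ => y :=
  fun _ _ _ => le_add_of_nonneg_right (WithBot.coe_nonneg.2 hk)

end UnitStep

section Exchange

variable {ι : Type*}

theorem exists_lt_of_sum_le_of_lt {R : Type*} [AddCommMonoid R] [LinearOrder R]
    [IsOrderedCancelAddMonoid R] {s : Finset ι} {f g : ι → R} {i : ι} (hi : i ∈ s)
    (hsum : ∑ j ∈ s, f j ≤ ∑ j ∈ s, g j) (hlt : g i < f i) : ∃ j ∈ s, f j < g j := by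
  by_contra! hle
  exact (Finset.sum_lt_sum hle ⟨i, hi, hlt⟩).not_ge hsum

theorem sum_update_add [DecidableEq ι] {R : Type*} [AddCommMonoid R] {s : Finset ι} {i : ι}
    (hi : i ∈ s) (z : ι → R) (β : R) :
    ∑ j ∈ s, Function.update z i β j + z i = ∑ j ∈ s, z j + β := by
  rw [Finset.sum_update_of_mem hi, Finset.sum_eq_add_sum_sdiff_singleton_of_mem hi z]
  abel

end Exchange

namespace FactorGraphModel

variable {V C : Type*}

/-- The factor functions encode the packing constraints with right-hand sides `b`. Only their zero
sets are prescribed, because the messages depend on nothing else. -/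
def HasCapacities [Fintype V] (M : FactorGraphModel V C) (b : C → ℕ) : Prop :=
  ∀ c z, M.Ψ c z = 0 ↔ ∑ v ∈ M.conNbrs c, z v ≤ b c

/-- The Karush-Kuhn-Tucker conditions for the relaxation of a packing problem: `x` is feasible, and
`y` is a vector of prices for the capacities `b` that satisfies complementary slackness and at which
no unit step towards `x v` lowers the net value `Φ v β - β * ∑ c ∈ varNbrs v, y c`. -/
structure IsDualCertificate [Fintype V] [Fintype C] (M : FactorGraphModel V C) (b : C → ℕ)
    (x : V → ℝ) (y : C → ℝ) : Prop where
  mem_Icc : ∀ v, x v ∈ Set.Icc 0 (M.X v : ℝ)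
  sum_le : ∀ c, ∑ v ∈ M.conNbrs c, x v ≤ b c
  nonneg : ∀ c, 0 ≤ y c
  eq_zero_of_lt : ∀ c, ∑ v ∈ M.conNbrs c, x v < b c → y c = 0
  stepLossLE : ∀ v (d : ℤˣ), StepLossLE (M.X v) d (x v) (-(d * ∑ c ∈ M.varNbrs v, y c))
    fun β => (M.Φ v β : WithBot ℝ)

theorem mem_zBox [Fintype V] {M : FactorGraphModel V C} {z : V → ℕ} :
    z ∈ M.zBox ↔ ∀ v, z v ≤ M.X v := by
  simp [zBox, alphabet]

theorem mem_varNbrs_iff_mem_conNbrs [Fintype V] [Fintype C] {M : FactorGraphModel V C} {v : V}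
    {c : C} : c ∈ M.varNbrs v ↔ v ∈ M.conNbrs c := by
  simp [varNbrs, conNbrs, M.G.adj_comm]

variable [Fintype V] [Fintype C] {M : FactorGraphModel V C} {b : C → ℕ} {x : V → ℝ} {y : C → ℝ}
  {μ : C → V → ℕ → WithBot ℝ} {d : ℤˣ} {t : ℕ} {c : C} {v : V} {β β' : ℕ}

theorem mem_delta : β ∈ M.delta t v ↔
    β ≤ M.X v ∧ ∀ γ ≤ M.X v, M.finalValue t v γ ≤ M.finalValue t v β := by
  have hX : ∀ γ, γ ∈ M.alphabet v ↔ γ ≤ M.X v := fun γ => by simp [alphabet]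
  rw [delta, Finset.mem_filter, hX]
  refine and_congr_right fun hβ => ⟨fun hsup γ hγ => ?_, fun hmax => ?_⟩
  · exact hsup ▸ Finset.le_sup ((hX γ).2 hγ)
  · exact le_antisymm (Finset.le_sup (f := M.finalValue t v) ((hX β).2 hβ))
      (Finset.sup_le fun γ hγ => hmax γ ((hX γ).1 hγ))

variable (M t v) in
theorem delta_nonempty : (M.delta t v).Nonempty := by
  obtain ⟨β, hβ, hmax⟩ := Finset.exists_max_image (Finset.Iic (M.X v)) (M.finalValue t v)
    Finset.nonempty_Iic
  exact ⟨β, mem_delta.2 ⟨Finset.mem_Iic.1 hβ, fun γ hγ => hmax γ (Finset.mem_Iic.2 hγ)⟩⟩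

open Classical in
theorem HasCapacities.conMessage_succ_le (hb : M.HasCapacities b) {B : WithBot ℝ}
    (h : ∀ z : V → ℕ, (∀ u, z u ≤ M.X u) → z v = β → ∑ u ∈ M.conNbrs c, z u ≤ b c →
      ∑ u ∈ M.conNbrs c \ {v}, M.varMessage (M.conMessage t) u c (z u) ≤ B) :
    M.conMessage (t + 1) c v β ≤ B :=
  Finset.sup_le fun z hz => by
    rw [Finset.mem_filter, mem_zBox, hb] at hz
    exact h z hz.1 hz.2.1 hz.2.2

open Classical in
theorem HasCapacities.le_conMessage_succ (hb : M.HasCapacities b) {z : V → ℕ}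
    (hX : ∀ u, z u ≤ M.X u) (hz : ∑ u ∈ M.conNbrs c, z u ≤ b c) :
    ∑ u ∈ M.conNbrs c \ {v}, M.varMessage (M.conMessage t) u c (z u) ≤
      M.conMessage (t + 1) c v (z v) :=
  Finset.le_sup (f := fun z : V → ℕ =>
    ∑ u ∈ M.conNbrs c \ {v}, M.varMessage (M.conMessage t) u c (z u))
    (Finset.mem_filter.2 ⟨mem_zBox.2 hX, rfl, (hb c z).2 hz⟩)

open Classical in
theorem HasCapacities.le_conMessage_succ_update (hb : M.HasCapacities b) {z : V → ℕ}
    (hX : ∀ u, z u ≤ M.X u) (hβ : β ≤ M.X v)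
    (hz : ∑ u ∈ M.conNbrs c, Function.update z v β u ≤ b c) :
    ∑ u ∈ M.conNbrs c \ {v}, M.varMessage (M.conMessage t) u c (z u) ≤
      M.conMessage (t + 1) c v β := by
  have hX' : ∀ u, Function.update z v β u ≤ M.X u :=
    (Function.forall_update_iff z fun u k => k ≤ M.X u).2 ⟨hβ, fun u _ => hX u⟩
  have hle := hb.le_conMessage_succ (t := t) (v := v) hX' hz
  rw [Function.update_self] at hle
  refine le_of_eq_of_le (Finset.sum_congr rfl fun u hu => ?_) hle
  rw [Function.update_of_ne (by simpa using (Finset.mem_sdiff.1 hu).2)]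

open Classical in
theorem HasCapacities.le_conMessage_succ_exchange (hb : M.HasCapacities b) {z : V → ℕ}
    (hX : ∀ u, z u ≤ M.X u) (hz : ∑ u ∈ M.conNbrs c, z u ≤ b c) (hv : v ∈ M.conNbrs c) {u : V}
    (hu : u ∈ M.conNbrs c \ {v}) {γ : ℕ} (hβ : β ≤ M.X v) (hγ : γ ≤ M.X u)
    (hβγ : β + γ = z v + z u) {k : ℝ} (hvar : M.varMessage (M.conMessage t) u c (z u) ≤
      M.varMessage (M.conMessage t) u c γ + k) :
    ∑ u ∈ M.conNbrs c \ {v}, M.varMessage (M.conMessage t) u c (z u) ≤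
      M.conMessage (t + 1) c v β + k := by
  obtain ⟨huc, huv⟩ := Finset.mem_sdiff.1 hu
  rw [Finset.mem_singleton] at huv
  set z' := Function.update z u γ
  have hX' : ∀ i, z' i ≤ M.X i :=
    (Function.forall_update_iff z fun i k => k ≤ M.X i).2 ⟨hγ, fun i _ => hX i⟩
  have hz' : ∑ i ∈ M.conNbrs c, Function.update z' v β i ≤ b c := by
    have h₁ := sum_update_add huc z γ
    have h₂ := sum_update_add hv z' β
    rw [show z' v = z v from Function.update_of_ne (Ne.symm huv) _ _] at h₂
    lia
  set ν := fun i => M.varMessage (M.conMessage t) i c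
  calc ∑ i ∈ M.conNbrs c \ {v}, ν i (z i)
      = ν u (z u) + ∑ i ∈ (M.conNbrs c \ {v}) \ {u}, ν i (z i) :=
        Finset.sum_eq_add_sum_sdiff_singleton_of_mem hu _
    _ ≤ ν u γ + k + ∑ i ∈ (M.conNbrs c \ {v}) \ {u}, ν i (z i) := by gcongr
    _ = ∑ i ∈ M.conNbrs c \ {v}, ν i (z' i) + k := by
        simp only [z', Function.apply_update (fun i => ν i), Finset.sum_update_of_mem hu]
        abel
    _ ≤ M.conMessage (t + 1) c v β + k := by
        gcongr
        exact hb.le_conMessage_succ_update hX' hβ hz'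

namespace IsDualCertificate

theorem feasible_update_or_sum_le [DecidableEq V] (h : M.IsDualCertificate b x y) {z : V → ℕ}
    (hv : v ∈ M.conNbrs c) (hz : ∑ u ∈ M.conNbrs c, z u ≤ b c) (hβ : (β : ℤ) = z v + d) :
    (∑ u ∈ M.conNbrs c, Function.update z v β u ≤ b c ∧ 0 ≤ d * y c) ∨
      -(d : ℝ) * ∑ u ∈ M.conNbrs c, (z u : ℝ) ≤ -d * ∑ u ∈ M.conNbrs c, x u := by
  have hupdate := sum_update_add hv z β
  rcases Int.units_eq_one_or d with rfl | rfl
  · by_cases hfeas : ∑ u ∈ M.conNbrs c, Function.update z v β u ≤ b c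
    · exact .inl ⟨hfeas, by simpa using h.nonneg c⟩
    · have hle : (b c : ℝ) ≤ ∑ u ∈ M.conNbrs c, (z u : ℝ) := by
        rw [Units.val_one] at hβ
        exact_mod_cast (show b c ≤ ∑ u ∈ M.conNbrs c, z u by lia)
      exact .inr (by simpa using (h.sum_le c).trans hle)
  · by_cases hslack : ∑ u ∈ M.conNbrs c, x u < b c
    · rw [Units.val_neg, Units.val_one] at hβ
      exact .inl ⟨by lia, by simp [h.eq_zero_of_lt c hslack]⟩
    · have hle : ∑ u ∈ M.conNbrs c, (z u : ℝ) ≤ b c := by exact_mod_cast hz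
      exact .inr (by simpa using hle.trans (not_lt.1 hslack))

open Classical in
theorem stepLossLE_conMessage_succ (h : M.IsDualCertificate b x y) (hb : M.HasCapacities b)
    (hv : v ∈ M.conNbrs c)
    (hvar : ∀ u ∈ M.conNbrs c, StepLossLE (M.X u) (-d) (x u) (d * y c)
      (M.varMessage (M.conMessage t) u c)) :
    StepLossLE (M.X v) d (x v) (d * y c) (M.conMessage (t + 1) c v) := by
  intro β β' hstep
  refine hb.conMessage_succ_le fun z hX hzv hz => ?_
  subst hzv
  rcases h.feasible_update_or_sum_le hv hz hstep.target_eq with ⟨hfeas, hloss⟩ | hsum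
  · exact (hb.le_conMessage_succ_update hX hstep.target_le hfeas).trans
      (le_add_of_nonneg_right (WithBot.coe_nonneg.2 hloss))
  · obtain ⟨u, hu, hlt⟩ : ∃ u ∈ M.conNbrs c, -(d : ℝ) * z u < -d * x u :=
      exists_lt_of_sum_le_of_lt hv (by simpa only [Finset.mul_sum] using hsum)
        (by linarith [hstep.towards])
    have huv : u ≠ v := by
      rintro rfl
      linarith [hstep.towards]
    obtain ⟨γ, hγ⟩ := exists_unitStep (d := -d) (h.mem_Icc u) (hX u) (by simpa using hlt)
    refine hb.le_conMessage_succ_exchange hX hz hv (by simp [hu, huv]) hstep.target_le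
      hγ.target_le ?_ (hvar u hu hγ)
    have h₁ := hstep.target_eq
    have h₂ := hγ.target_eq
    rw [Units.val_neg] at h₂
    lia

theorem stepLossLE_varMessage (h : M.IsDualCertificate b x y) (hc : c ∈ M.varNbrs v)
    (hμ : ∀ c' ∈ M.varNbrs v, StepLossLE (M.X v) d (x v) (d * y c') (μ c' v)) :
    StepLossLE (M.X v) d (x v) (-(d * y c)) (M.varMessage μ v c) := by
  classical
  have hsum := (h.stepLossLE v d).add (StepLossLE.sum (s := M.varNbrs v \ {c})
    fun c' hc' => hμ c' (Finset.mem_sdiff.1 hc').1)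
  rw [← Finset.mul_sum, Finset.sum_eq_add_sum_sdiff_singleton_of_mem hc y] at hsum
  convert hsum using 1
  · ring
  · unfold varMessage
    congr!

theorem stepLossLE_conMessage (h : M.IsDualCertificate b x y) (hb : M.HasCapacities b) (t : ℕ)
    (hv : v ∈ M.conNbrs c) :
    StepLossLE (M.X v) ((-1) ^ t) (x v) (((-1) ^ t : ℤˣ) * y c) (M.conMessage t c v) := by
  induction t generalizing c v with
  | zero => exact StepLossLE.const (by simpa using h.nonneg c)
  | succ t ih =>
    refine h.stepLossLE_conMessage_succ hb hv fun u hu => ?_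
    have := h.stepLossLE_varMessage (mem_varNbrs_iff_mem_conNbrs.2 hu) fun c' hc' =>
      ih (mem_varNbrs_iff_mem_conNbrs.1 hc')
    convert this using 1 <;> simp [pow_succ]

theorem stepLossLE_finalValue (h : M.IsDualCertificate b x y) (hb : M.HasCapacities b) (t : ℕ)
    (v : V) : StepLossLE (M.X v) ((-1) ^ t) (x v) 0 (M.finalValue t v) := by
  have hsum := (h.stepLossLE v ((-1) ^ t)).add (StepLossLE.sum fun c hc =>
    h.stepLossLE_conMessage hb t (mem_varNbrs_iff_mem_conNbrs.1 hc))
  rwa [← Finset.mul_sum, neg_add_cancel] at hsum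

theorem mem_delta_of_unitStep (h : M.IsDualCertificate b x y) (hb : M.HasCapacities b)
    (hβ : β ∈ M.delta t v) (hstep : UnitStep (M.X v) ((-1) ^ t) (x v) β β') :
    β' ∈ M.delta t v := by
  have hle : M.finalValue t v β ≤ M.finalValue t v β' := by
    simpa using h.stepLossLE_finalValue hb t v hstep
  exact mem_delta.2 ⟨hstep.target_le, fun γ hγ => ((mem_delta.1 hβ).2 γ hγ).trans hle⟩

theorem le_of_isGreatest_delta (h : M.IsDualCertificate b x y) (hb : M.HasCapacities b)
    (ht : Even t) (hβ : IsGreatest {β | β ∈ M.delta t v} β) : x v ≤ β := by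
  by_contra! hlt
  obtain ⟨β', hstep⟩ := exists_unitStep (d := (-1) ^ t) (h.mem_Icc v) (mem_delta.1 hβ.1).1
    (by simpa [ht] using hlt)
  have hle : β' ≤ β := hβ.2 (h.mem_delta_of_unitStep hb hβ.1 hstep)
  have : (β' : ℤ) = β + 1 := by simpa [ht] using hstep.target_eq
  lia

theorem le_of_isLeast_delta (h : M.IsDualCertificate b x y) (hb : M.HasCapacities b)
    (ht : Odd t) (hβ : IsLeast {β | β ∈ M.delta t v} β) : (β : ℝ) ≤ x v := by
  by_contra! hlt
  obtain ⟨β', hstep⟩ := exists_unitStep (d := (-1) ^ t) (h.mem_Icc v) (mem_delta.1 hβ.1).1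
    (by simpa [ht] using hlt)
  have hle : β ≤ β' := hβ.2 (h.mem_delta_of_unitStep hb hβ.1 hstep)
  have : (β' : ℤ) = β + -1 := by simpa [ht] using hstep.target_eq
  lia

end IsDualCertificate

end FactorGraphModel

namespace PackingInstance

variable {m n : ℕ} (P : PackingInstance m n)

theorem isCompact_lpFeasible : IsCompact P.lpFeasible := by
  have hbox : P.lpFeasible = {x | P.A.mulVec x ≤ fun j => (P.b j : ℝ)} ∩
      Set.univ.pi fun i => Set.Icc 0 (P.X i : ℝ) := by
    ext x
    simp [lpFeasible, -Set.pi_univ_Icc]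
  rw [hbox]
  exact (isCompact_univ_pi fun _ => isCompact_Icc).inter_left
    (isClosed_le (by fun_prop) continuous_const)

theorem zero_mem_lpFeasible : 0 ∈ P.lpFeasible :=
  ⟨fun j => by simp, fun i => by simp⟩

theorem continuous_weight : Continuous fun x : Fin n → ℝ => P.w ⬝ᵥ x :=
  continuous_const.dotProduct continuous_id

theorem isCompact_optLP : IsCompact P.optLP := by
  have hinter : P.optLP = P.lpFeasible ∩ ⋂ y ∈ P.lpFeasible, {x | P.w ⬝ᵥ y ≤ P.w ⬝ᵥ x} := by
    ext x
    simp [optLP]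
  rw [hinter]
  exact P.isCompact_lpFeasible.inter_right <| isClosed_biInter fun y _ =>
    isClosed_le continuous_const P.continuous_weight

theorem optLP_nonempty : P.optLP.Nonempty := by
  obtain ⟨x, hx, hmax⟩ := P.isCompact_lpFeasible.exists_isMaxOn ⟨0, P.zero_mem_lpFeasible⟩
    P.continuous_weight.continuousOn
  exact ⟨x, hx, fun y hy => hmax hy⟩

theorem isCompact_optLP_coord (r : Fin n) : IsCompact {a | ∃ x ∈ P.optLP, x r = a} :=
  P.isCompact_optLP.image (continuous_apply r)

theorem optLP_coord_nonempty (r : Fin n) : {a | ∃ x ∈ P.optLP, x r = a}.Nonempty :=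
  P.optLP_nonempty.image fun x : Fin n → ℝ => x r

variable {P}

theorem mem_varNbrs {v : Fin n} {c : Fin m} : c ∈ P.model.varNbrs v ↔ P.A c v = 1 := by
  classical exact Finset.mem_filter_univ c

theorem mem_conNbrs {v : Fin n} {c : Fin m} : v ∈ P.model.conNbrs c ↔ P.A c v = 1 := by
  classical exact Finset.mem_filter_univ v

variable (P)

theorem sum_conNbrs (c : Fin m) (x : Fin n → ℝ) :
    ∑ v ∈ P.model.conNbrs c, x v = P.A.mulVec x c := by
  rw [Matrix.mulVec, dotProduct, ← Finset.sum_subset (Finset.subset_univ (P.model.conNbrs c))]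
  · exact Finset.sum_congr rfl fun v hv => by rw [mem_conNbrs.1 hv, one_mul]
  · intro v _ hv
    rw [(P.zero_one c v).resolve_right (mt mem_conNbrs.2 hv), zero_mul]

theorem sum_varNbrs (v : Fin n) (y : Fin m → ℝ) :
    ∑ c ∈ P.model.varNbrs v, y c = Matrix.vecMul y P.A v := by
  rw [Matrix.vecMul, dotProduct, ← Finset.sum_subset (Finset.subset_univ (P.model.varNbrs v))]
  · exact Finset.sum_congr rfl fun c hc => by rw [mem_varNbrs.1 hc, mul_one]
  · intro c _ hc
    rw [(P.zero_one c v).resolve_right (mt mem_varNbrs.2 hc), mul_zero]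

theorem hasCapacities_model : P.model.HasCapacities P.b := by
  intro c z
  change (if ∑ v ∈ P.model.conNbrs c, z v ≤ P.b c then (0 : WithBot ℝ) else ⊥) = 0 ↔ _
  split_ifs with h <;> simp [h]

variable {P}

theorem stepLossLE_weight {v : Fin n} {a p : ℝ} (hle : 0 < a → p ≤ P.w v)
    (hge : a < P.X v → P.w v ≤ p) (d : ℤˣ) :
    StepLossLE (P.X v) d a (-(d * p)) fun β => (P.model.Φ v β : WithBot ℝ) := by
  intro β β' hstep
  have hβ' : (β' : ℝ) = β + d := by exact_mod_cast hstep.target_eq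
  have htowards := hstep.towards
  have hprice : d * p ≤ d * P.w v := by
    rcases Int.units_eq_one_or d with rfl | rfl
    · have hlt : (β : ℝ) < a := by simpa using htowards
      simpa using hle ((Nat.cast_nonneg β).trans_lt hlt)
    · have hlt : a < β := by simpa using htowards
      simpa using hge (hlt.trans_le (Nat.cast_le.2 hstep.source_le))
  have hreal : P.w v * β ≤ P.w v * β' + -(d * p) := by
    rw [hβ']
    linarith
  exact WithBot.coe_le_coe.2 hreal

theorem exists_isDualCertificate {x : Fin n → ℝ} (hx : x ∈ P.optLP) :
    ∃ y, P.model.IsDualCertificate P.b x y := by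
  obtain ⟨y, hy, hslack, hle, hge⟩ := exists_shadowPrices hx.1 hx.2
  refine ⟨y, hx.1.2, fun c => ?_, hy, fun c hc => ?_, fun v d => ?_⟩
  · exact (P.sum_conNbrs c x).trans_le (hx.1.1 c)
  · exact hslack c (P.sum_conNbrs c x ▸ hc)
  · rw [P.sum_varNbrs v y]
    exact stepLossLE_weight (hle v) (hge v) d

end PackingInstance

end MinSum

theorem theorem1 {m n : ℕ} (P : MinSum.PackingInstance m n) (t : ℕ) (r : Fin n) :
    (Even t → ∃ (βmax : ℕ) (xmax : ℝ),
      IsGreatest {β | β ∈ P.model.delta t r} βmax ∧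
      IsGreatest {a | ∃ x ∈ P.optLP, x r = a} xmax ∧
      xmax ≤ (βmax : ℝ)) ∧
    (Odd t → ∃ (βmin : ℕ) (xmin : ℝ),
      IsLeast {β | β ∈ P.model.delta t r} βmin ∧
      IsLeast {a | ∃ x ∈ P.optLP, x r = a} xmin ∧
      (βmin : ℝ) ≤ xmin) := by
  have hcap := P.hasCapacities_model
  have hδ := P.model.delta_nonempty t r
  refine ⟨fun ht => ?_, fun ht => ?_⟩
  · have hβ := Finset.isGreatest_max' _ hδ
    obtain ⟨_, hmax⟩ := (P.isCompact_optLP_coord r).exists_isGreatest (P.optLP_coord_nonempty r)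
    obtain ⟨x, hx, rfl⟩ := hmax.1
    obtain ⟨y, hy⟩ := MinSum.PackingInstance.exists_isDualCertificate hx
    exact ⟨_, _, hβ, hmax, hy.le_of_isGreatest_delta hcap ht hβ⟩
  · have hβ := Finset.isLeast_min' _ hδ
    obtain ⟨_, hmin⟩ := (P.isCompact_optLP_coord r).exists_isLeast (P.optLP_coord_nonempty r)
    obtain ⟨x, hx, rfl⟩ := hmin.1
    obtain ⟨y, hy⟩ := MinSum.PackingInstance.exists_isDualCertificate hx
    exact ⟨_, _, hβ, hmin, hy.le_of_isLeast_delta hcap ht hβ⟩
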